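/- Let $A$ be a $C^*$-algebra (not necessarily unital), let $n\ge 0$, and let $X=(X^{\mathbf m})_{\mathbf m\in\mathbb N^n}$ be a proper $\mathbb N^n$-product system over $A$: that is, $X^{\mathbf 0}=A$, every $X^{\mathbf m}$ with $\mathbf m\ne\mathbf 0$ is a right Hilbert $A$-module with a left action of $A$ given by a $*$-homomorphism $\varphi^{\mathbf m}\colon A\to\mathcal K(X^{\mathbf m})$ into the compact operators, and there are associative multiplication isomorphisms of correspondences $X^{\mathbf m}\otimes_A X^{\mathbf k}\cong X^{\mathbf m+\mathbf k}$ for all nonzero $\mathbf m,\mathbf k$. Ideals of $A$ are closed and two-sided. For an ideal $I$ of $A$ and $\mathbf m\neq\mathbf 0$ put $$(X^{\mathbf m})^{-1}(I)=\{a\in A: a\cdot X^{\mathbf m}\subseteq X^{\mathbf m}I\},$$ which is again an ideal of $A$, and let $(X^{\mathbf 0})^{-1}$ be the identity map. Write $[n]=\{1,\dots,n\}$, $\mathbf 1=(1,\dots,1)$, $\mathbf 1_F\in\mathbb N^n$ for the characteristic vector of $F\subseteq[n]$, and $\mathbf 1_i=\mathbf 1_{\{i\}}$. A family $K=(K^F)_{F\subseteq[n]}$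 of ideals of $A$ is called an *invariant family* if $K^G=(X^{\mathbf 1_i})^{-1}(K^G\cap K^{G\cup\{i\}})$ for all $G\subseteq[n]$ and $i\in[n]\setminus G$. A family $I=(I^F)_{F\subseteq[n]}$ of ideals of $A$ is called a *T-family* if $I^F=(X^{\mathbf 1_i})^{-1}(I^F)\cap I^{F\cup\{i\}}$ for all $F\subseteq[n]$ and $i\in[n]\setminus F$. Both sets of families are ordered by componentwise inclusion. **Proposition.** With these orders the set of invariant families and the set of T-families are lattices. If $K$ is an invariant family, then $I_K$, defined by $I_K^F=\bigcap_{F\subseteq G\subseteq[n]}K^G$, is a T-family; if $I$ is a T-family, then $K_I$, defined by $K_I^F=(X^{\mathbf 1-\mathbf 1_F})^{-1}(I^F)$, is an invariant family; and the maps $K\mapsto I_K$ and $I\mapsto K_I$ are mutually inverse lattice isomorphisms between the set of invariant families and the set of T-families. -/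

import Mathlib

open MulOpposite

universe u u₁ u₂ v v₁ v₂ v₃

/-! ### Ideals of a C⋆-algebra -/

/-- Ideals of a C⋆-algebra are, as usual, norm-closed two-sided ideals, ordered by inclusion. -/
abbrev ClosedIdeal (A : Type u) [NonUnitalCStarAlgebra A] : Type u :=
  {I : TwoSidedIdeal A // IsClosed (I : Set A)}

namespace ClosedIdeal

variable {A : Type u} [NonUnitalCStarAlgebra A]

/-- The intersection of a set of closed ideals. -/
instance instInfSet : InfSet (ClosedIdeal A) where
  sInf S := ⟨sInf (Subtype.val '' S), by
    have h : ((sInf (Subtype.val '' S) : TwoSidedIdeal A) : Set A)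
        = ⋂ I ∈ S, ((I : ClosedIdeal A).1 : Set A) := by
      ext x
      simp only [SetLike.mem_coe, TwoSidedIdeal.mem_sInf, Set.mem_iInter]
      exact ⟨fun h I hI => h _ ⟨I, hI, rfl⟩, by rintro h _ ⟨I, hI, rfl⟩; exact h I hI⟩
    rw [h]
    exact isClosed_biInter fun I _ => I.2⟩

/-- The closed ideals form a complete lattice, with infima given by intersections. -/
instance instCompleteLattice : CompleteLattice (ClosedIdeal A) :=
  completeLatticeOfInf (ClosedIdeal A) fun S =>
    ⟨fun I hI => sInf_le (α := TwoSidedIdeal A) ⟨I, hI, rfl⟩,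
      fun _ hJ => le_sInf (α := TwoSidedIdeal A) (by rintro _ ⟨I, hI, rfl⟩; exact hJ hI)⟩

theorem mem_sInf {S : Set (ClosedIdeal A)} {x : A} : x ∈ (sInf S).1 ↔ ∀ I ∈ S, x ∈ I.1 := by
  change x ∈ sInf (Subtype.val '' S) ↔ _
  rw [TwoSidedIdeal.mem_sInf]
  exact ⟨fun h I hI => h _ ⟨I, hI, rfl⟩, by rintro h _ ⟨I, hI, rfl⟩; exact h I hI⟩

theorem mem_inf {I J : ClosedIdeal A} {x : A} : x ∈ (I ⊓ J).1 ↔ x ∈ I.1 ∧ x ∈ J.1 := by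
  change x ∈ (sInf {I, J} : ClosedIdeal A).1 ↔ _
  rw [mem_sInf]
  simp only [Set.mem_insert_iff, Set.mem_singleton_iff, forall_eq_or_imp, forall_eq]

end ClosedIdeal

/-! ### C⋆-correspondences -/

/-- An `A`-`B`-correspondence: a (complete) right Hilbert `B`-module with a `⋆`-homomorphism from
`A` to the adjointable operators.

Mathlib's `CStarModule B E` is about left modules, so that a right Hilbert `B`-module is a
`CStarModule Bᵐᵒᵖ E`: the element `x · b` is `op b • x`, and the `B`-valued inner product
`⟨x, y⟩` is the element `unop (inner Bᵐᵒᵖ x y)`. It is linear in the second variable,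
`⟨x, y · b⟩ = ⟨x, y⟩ b`, and `‖x‖ = ‖⟨x, x⟩‖ ^ (1/2)`. -/
structure Correspondence (A : Type u₁) (B : Type u₂) [NonUnitalCStarAlgebra A]
    [NonUnitalCStarAlgebra B] [PartialOrder B] [StarOrderedRing B] where
  carrier : Type v
  [instNormedAddCommGroup : NormedAddCommGroup carrier]
  [instNormedSpace : NormedSpace ℂ carrier]
  [instCompleteSpace : CompleteSpace carrier]
  [instSMul : SMul Bᵐᵒᵖ carrier]
  [instCStarModule : CStarModule Bᵐᵒᵖ carrier]
  /-- The left action of `A` by bounded operators. -/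
  act : A →ₙₐ[ℂ] (carrier →L[ℂ] carrier)
  /-- Each `act a` is adjointable, with adjoint `act (star a)`. -/
  inner_act_star : ∀ (a : A) (x y : carrier),
    inner Bᵐᵒᵖ (act (star a) x) y = inner Bᵐᵒᵖ x (act a y)

namespace Correspondence

attribute [instance] instNormedAddCommGroup instNormedSpace instCompleteSpace instSMul
  instCStarModule

instance instCoeSort {A : Type u₁} {B : Type u₂} [NonUnitalCStarAlgebra A]
    [NonUnitalCStarAlgebra B] [PartialOrder B] [StarOrderedRing B] :
    CoeSort (Correspondence.{u₁, u₂, v} A B) (Type v) := ⟨carrier⟩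

section

variable {A : Type u₁} {B : Type u₂} [NonUnitalCStarAlgebra A]
  [NonUnitalCStarAlgebra B] [PartialOrder B] [StarOrderedRing B]
  (Y : Correspondence.{u₁, u₂, v} A B)

/-- The `B`-valued inner product `⟨x, y⟩`. -/
def ip (x y : Y) : B := unop (inner Bᵐᵒᵖ x y)

/-- The compact operators on `Y`: the closed linear span, in operator norm, of the rank-one
operators `z ↦ y · ⟨x, z⟩`. -/
noncomputable def compactOperators : Submodule ℂ (Y →L[ℂ] Y) :=
  (Submodule.span ℂ {T : Y →L[ℂ] Y |
    ∃ x y : Y, ∀ z : Y, T z = op (Y.ip x z) • y}).topologicalClosure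

/-- The correspondence is proper if `A` acts by compact operators. -/
def IsProper : Prop := ∀ a : A, Y.act a ∈ Y.compactOperators

/-- The closed submodule `Y I` of `Y`, for an ideal `I` of `B`. -/
def mulIdeal (I : ClosedIdeal B) : Submodule ℂ Y :=
  (Submodule.span ℂ {z : Y | ∃ y : Y, ∃ b ∈ I.1, z = op b • y}).topologicalClosure

theorem ext_inner {z w : Y} (h : ∀ x : Y, inner Bᵐᵒᵖ x z = inner Bᵐᵒᵖ x w) : z = w := by
  rw [← sub_eq_zero, ← CStarModule.inner_self (A := Bᵐᵒᵖ), CStarModule.inner_sub_right, h,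
    sub_self]

theorem act_smul (a : A) (b : B) (y : Y) : Y.act a (op b • y) = op b • Y.act a y := by
  refine Y.ext_inner fun x => ?_
  rw [← inner_act_star, CStarModule.inner_op_smul_right, CStarModule.inner_op_smul_right,
    inner_act_star]

/-- The extension of the left action to the unitization of `A`. -/
noncomputable def unitAct (w : Unitization ℂ A) (x : Y) : Y := w.fst • x + Y.act w.snd x

theorem unitAct_mul (w w' : Unitization ℂ A) (x : Y) :
    Y.unitAct (w * w') x = Y.unitAct w (Y.unitAct w' x) := by
  simp only [unitAct, Unitization.fst_mul, Unitization.snd_mul, map_add, map_smul, map_mul,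
    add_apply, FunLike.coe_smul, Pi.smul_apply, smul_add,
    mul_smul]
  abel

theorem inner_unitAct_star (w : Unitization ℂ A) (x y : Y) :
    inner Bᵐᵒᵖ (Y.unitAct (star w) x) y = inner Bᵐᵒᵖ x (Y.unitAct w y) := by
  simp [unitAct, inner_act_star]

theorem norm_act_le (a : A) (x : Y) : ‖Y.act a x‖ ≤ ‖a‖ * ‖x‖ := by
  have hnn : (0 : Unitization ℂ A) ≤ algebraMap ℝ (Unitization ℂ A) (‖a‖ ^ 2)
      - star (a : Unitization ℂ A) * (a : Unitization ℂ A) := by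
    rw [sub_nonneg, ← Unitization.norm_inr (𝕜 := ℂ) (a := a)]
    exact CStarAlgebra.star_mul_le_algebraMap_norm_sq
  obtain ⟨b, hb⟩ := CStarAlgebra.nonneg_iff_eq_star_mul_self.1 hnn
  have h1 : inner Bᵐᵒᵖ (Y.act a x) (Y.act a x) ≤ (‖a‖ ^ 2) • inner Bᵐᵒᵖ x x := by
    rw [← sub_nonneg]
    have h2 : 0 ≤ inner Bᵐᵒᵖ x (Y.unitAct (star b * b) x) := by
      rw [unitAct_mul, ← inner_unitAct_star, star_star]
      exact CStarModule.inner_self_nonneg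
    rw [← hb] at h2
    have h3 : Y.unitAct (algebraMap ℝ (Unitization ℂ A) (‖a‖ ^ 2)
        - star (a : Unitization ℂ A) * (a : Unitization ℂ A)) x
        = (‖a‖ ^ 2) • x - Y.act (star a) (Y.act a x) := by
      rw [IsScalarTower.algebraMap_apply ℝ ℂ (Unitization ℂ A), Unitization.algebraMap_eq_inl,
        ← Unitization.inr_star, ← Unitization.inr_mul]
      simp [unitAct, sub_eq_add_neg, ← Complex.coe_smul]
    rw [h3, CStarModule.inner_sub_right, CStarModule.inner_smul_right_real, ← inner_act_star,
      star_star] at h2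
    exact h2
  have h4 : ‖Y.act a x‖ ^ 2 ≤ (‖a‖ * ‖x‖) ^ 2 := by
    rw [CStarModule.norm_sq_eq (A := Bᵐᵒᵖ), mul_pow, CStarModule.norm_sq_eq (A := Bᵐᵒᵖ) (x := x)]
    refine (CStarAlgebra.norm_le_norm_of_nonneg_of_le CStarModule.inner_self_nonneg h1).trans ?_
    rw [norm_smul, Real.norm_of_nonneg (by positivity)]
  exact le_of_sq_le_sq h4 (by positivity)

theorem continuous_act (x : Y) : Continuous fun a : A => Y.act a x := by
  have : (fun a : A => Y.act a x) =
      (({ toFun := fun a => Y.act a x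
          map_add' := by simp
          map_smul' := by simp } : A →ₗ[ℂ] Y).mkContinuous ‖x‖
        fun a => by simpa [mul_comm] using Y.norm_act_le a x) := rfl
  rw [this]
  exact ContinuousLinearMap.continuous _

theorem act_mem_mulIdeal (I : ClosedIdeal B) (a : A) {y : Y} (hy : y ∈ Y.mulIdeal I) :
    Y.act a y ∈ Y.mulIdeal I := by
  have hle : Y.mulIdeal I ≤ (Y.mulIdeal I).comap (Y.act a).toLinearMap := by
    refine Submodule.topologicalClosure_minimal _ (Submodule.span_le.2 ?_) ?_
    · rintro _ ⟨z, b, hb, rfl⟩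
      refine Submodule.le_topologicalClosure _ (Submodule.subset_span ⟨Y.act a z, b, hb, ?_⟩)
      exact Y.act_smul a b z
    · exact (Submodule.isClosed_topologicalClosure _).preimage (Y.act a).continuous
  exact hle hy

/-- The ideal `Y⁻¹(I) = {a ∈ A | a · Y ⊆ Y I}` of `A`, for an ideal `I` of `B`. -/
def preimage (I : ClosedIdeal B) : ClosedIdeal A :=
  ⟨TwoSidedIdeal.mk' {a : A | ∀ y : Y, Y.act a y ∈ Y.mulIdeal I}
    (fun y => by simp)
    (fun ha hb y => by simpa using add_mem (ha y) (hb y))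
    (fun ha y => by simpa using ha y)
    (fun {a b} hb y => by simpa using Y.act_mem_mulIdeal I a (hb y))
    (fun {a b} ha y => by simpa using ha (Y.act b y)), by
    have h : {a : A | ∀ y : Y, Y.act a y ∈ Y.mulIdeal I}
        = ⋂ y : Y, (fun a : A => Y.act a y) ⁻¹' (Y.mulIdeal I : Set Y) := by
      ext a; simp
    rw [TwoSidedIdeal.coe_mk', h]
    exact isClosed_iInter fun y =>
      (Submodule.isClosed_topologicalClosure _).preimage (Y.continuous_act y)⟩

theorem mem_preimage {I : ClosedIdeal B} {a : A} :
    a ∈ (Y.preimage I).1 ↔ ∀ y : Y, Y.act a y ∈ Y.mulIdeal I :=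
  by
  rw [preimage, TwoSidedIdeal.mem_mk']
  rfl

end

/-- An isomorphism of `A`-`C`-correspondences `X ⊗_B Y ≅ Z`, where `X ⊗_B Y` is the interior tensor
product, i.e. the Hausdorff completion of the algebraic tensor product for the inner product
`⟨x₁ ⊗ y₁, x₂ ⊗ y₂⟩ = ⟨y₁, ⟨x₁, x₂⟩ · y₂⟩`. It is given by the images `x · y` in `Z` of the
elementary tensors: a bilinear `B`-balanced map, respecting the inner products, both actions, and
with total range (an isometry of complete spaces with dense range is onto). -/
structure TensorIso {A : Type u} {B : Type u₁} {C : Type u₂} [NonUnitalCStarAlgebra A]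
    [NonUnitalCStarAlgebra B] [PartialOrder B] [StarOrderedRing B]
    [NonUnitalCStarAlgebra C] [PartialOrder C] [StarOrderedRing C]
    (X : Correspondence.{u, u₁, v₁} A B) (Y : Correspondence.{u₁, u₂, v₂} B C)
    (Z : Correspondence.{u, u₂, v₃} A C) where
  mul : X →ₗ[ℂ] Y →ₗ[ℂ] Z
  balanced : ∀ (x : X) (b : B) (y : Y), mul (op b • x) y = mul x (Y.act b y)
  inner_mul : ∀ (x₁ x₂ : X) (y₁ y₂ : Y),
    Z.ip (mul x₁ y₁) (mul x₂ y₂) = Y.ip y₁ (Y.act (X.ip x₁ x₂) y₂)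
  act_mul : ∀ (a : A) (x : X) (y : Y), mul (X.act a x) y = Z.act a (mul x y)
  mul_smul : ∀ (x : X) (y : Y) (c : C), mul x (op c • y) = op c • mul x y
  dense : (Submodule.span ℂ {z : Z | ∃ x y, z = mul x y}).topologicalClosure = ⊤

end Correspondence

/-! ### Product systems -/

/-- An `ℕⁿ`-product system over `A`. The fibre over `0` is `A` itself and carries no further data,
so that only the fibres over nonzero `m` are listed. The isomorphism `X^m ⊗_A X^k ≅ X^(m + k)` is
indexed by `m`, `k` and the sum `l = m + k`, which avoids transports between equal indices in the
associativity law `(x · y) · z = x · (y · z)`. -/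
structure ProductSystem (n : ℕ) (A : Type u) [NonUnitalCStarAlgebra A] [PartialOrder A]
    [StarOrderedRing A] where
  fiber : {m : Fin n → ℕ // m ≠ 0} → Correspondence.{u, u, v} A A
  mulIso : ∀ m k l : {m : Fin n → ℕ // m ≠ 0}, m.1 + k.1 = l.1 →
    Correspondence.TensorIso (fiber m) (fiber k) (fiber l)
  assoc : ∀ (m k l mk kl p : {m : Fin n → ℕ // m ≠ 0}) (h₁ : m.1 + k.1 = mk.1)
    (h₂ : k.1 + l.1 = kl.1) (h₃ : mk.1 + l.1 = p.1) (h₄ : m.1 + kl.1 = p.1)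
    (x : fiber m) (y : fiber k) (z : fiber l),
    (mulIso mk l p h₃).mul ((mulIso m k mk h₁).mul x y) z =
      (mulIso m kl p h₄).mul x ((mulIso k l kl h₂).mul y z)

/-- The characteristic vector `1_F ∈ ℕⁿ` of a subset `F` of `{1, …, n}`. -/
def charVec {n : ℕ} (F : Finset (Fin n)) : Fin n → ℕ := fun i => if i ∈ F then 1 else 0

/-- A partially ordered set is a lattice: any two elements have a least upper bound and a greatest
lower bound. -/
def IsLatticeOrder (P : Type*) [PartialOrder P] : Prop :=
  ∀ a b : P, (∃ c, IsLUB {a, b} c) ∧ ∃ c, IsGLB {a, b} c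

namespace ProductSystem

variable {n : ℕ} {A : Type u} [NonUnitalCStarAlgebra A] [PartialOrder A] [StarOrderedRing A]
  (X : ProductSystem.{u, v} n A)

/-- A product system is proper if all its fibres are. -/
def IsProper : Prop := ∀ m, (X.fiber m).IsProper

/-- The map `(X^m)⁻¹` on ideals of `A`, with `(X^0)⁻¹` the identity. -/
def preimage (m : Fin n → ℕ) (I : ClosedIdeal A) : ClosedIdeal A :=
  if h : m = 0 then I else (X.fiber ⟨m, h⟩).preimage I

/-- `K^G = (X^{1_i})⁻¹(K^G ∩ K^{G ∪ {i}})` for all `G ⊆ [n]` and `i ∈ [n] \ G`. -/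
def IsInvariantFamily (K : Finset (Fin n) → ClosedIdeal A) : Prop :=
  ∀ (G : Finset (Fin n)) (i : Fin n), i ∉ G →
    K G = X.preimage (charVec {i}) (K G ⊓ K (insert i G))

/-- `I^F = (X^{1_i})⁻¹(I^F) ∩ I^{F ∪ {i}}` for all `F ⊆ [n]` and `i ∈ [n] \ F`. -/
def IsTFamily (I : Finset (Fin n) → ClosedIdeal A) : Prop :=
  ∀ (F : Finset (Fin n)) (i : Fin n), i ∉ F →
    I F = X.preimage (charVec {i}) (I F) ⊓ I (insert i F)

/-- The set of invariant families, ordered by componentwise inclusion. -/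
abbrev InvariantFamily : Type u :=
  {K : Finset (Fin n) → ClosedIdeal A // X.IsInvariantFamily K}

/-- The set of T-families, ordered by componentwise inclusion. -/
abbrev TFamily : Type u :=
  {I : Finset (Fin n) → ClosedIdeal A // X.IsTFamily I}

/-- The family `I_K`, with `I_K^F = ⋂_{G ⊇ F} K^G`. -/
def interFamily (K : Finset (Fin n) → ClosedIdeal A) : Finset (Fin n) → ClosedIdeal A :=
  fun F => ⨅ G : Finset (Fin n), ⨅ _ : F ⊆ G, K G

/-- The family `K_I`, with `K_I^F = (X^{1 - 1_F})⁻¹(I^F)`, where `1 = (1, …, 1)`. -/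
def preimageFamily (I : Finset (Fin n) → ClosedIdeal A) : Finset (Fin n) → ClosedIdeal A :=
  fun F => X.preimage (1 - charVec F) (I F)

end ProductSystem

/-! Write `p_m` for `(X^m)⁻¹`. A vector lies in `Y I` exactly when all its inner products lie in `I`
(`mem_mulIdeal`), so `p_m` preserves arbitrary intersections, and testing on elementary tensors
gives `p_(m+k) = p_m ∘ p_k` (`TensorIso.preimage_eq`). What remains is combinatorics of commuting,
meet-preserving maps `p_i` on a complete lattice. Iterating the two defining identities over the
elements of a set `S` disjoint from `F` gives `I^F = ⋂_{T ⊆ S} p_{S \ T}(I^{F ∪ T})` for T-families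
and `p_S(⋂_{T ⊆ S} K^{F ∪ T}) = K^F` for invariant families. At `S = Fᶜ` these say that the two maps
are mutually inverse. T-families are closed under intersections, hence form a lattice, and the
isomorphism carries this to invariant families. -/

/-! ### Approximation in Hilbert modules. -/

namespace CStarModule

variable {B E : Type*} [NonUnitalCStarAlgebra B] [PartialOrder B]
  [NormedAddCommGroup E] [NormedSpace ℂ E] [SMul B E] [CStarModule B E]

/-- A vector `z` is a limit of vectors `(w * ⟪z, z⟫) • z`. -/
theorem exists_norm_sub_mul_inner_self_smul_le (z : E) {δ : ℝ} (hδ : 0 < δ) :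
    ∃ w : B, ‖z - (w * inner B z z) • z‖ ^ 2 ≤ δ := by
  set b : B := inner B z z with hb
  have hbs : IsSelfAdjoint b := isSelfAdjoint_inner_self
  have hpos : ∀ t : ℝ, t ^ 2 + δ ^ 2 ≠ 0 := fun t => by positivity
  have hg : Continuous fun t : ℝ => t / (t ^ 2 + δ ^ 2) :=
    continuous_id.div (by fun_prop) hpos
  have hf : Continuous fun t : ℝ => t / (t ^ 2 + δ ^ 2) * t := hg.mul continuous_id
  have hft : Continuous fun t : ℝ => t / (t ^ 2 + δ ^ 2) * t * t := hf.mul continuous_id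
  have hftf : Continuous fun t : ℝ => t / (t ^ 2 + δ ^ 2) * t * t * (t / (t ^ 2 + δ ^ 2) * t) :=
    hft.mul hf
  have hid : cfcₙ (fun t : ℝ => t) b = b := cfcₙ_id' ℝ b
  -- A regularised `1 / t` vanishing at `0`, as the non-unital calculus requires. Then `w * b` is
  -- `t² / (t² + δ²)` applied to `b`, which tends to `1` off `0` as `δ → 0`.
  refine ⟨cfcₙ (fun t : ℝ => t / (t ^ 2 + δ ^ 2)) b, ?_⟩
  set u : B := cfcₙ (fun t : ℝ => t / (t ^ 2 + δ ^ 2)) b * b with hu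
  have hu' : u = cfcₙ (fun t : ℝ => t / (t ^ 2 + δ ^ 2) * t) b := by
    rw [cfcₙ_mul (fun t : ℝ => t / (t ^ 2 + δ ^ 2)) (fun t => t) b hg.continuousOn (by simp)
      continuousOn_id rfl, hid]
  have hub : u * b = cfcₙ (fun t : ℝ => t / (t ^ 2 + δ ^ 2) * t * t) b := by
    rw [cfcₙ_mul (fun t : ℝ => t / (t ^ 2 + δ ^ 2) * t) (fun t => t) b hf.continuousOn (by simp)
      continuousOn_id rfl, hid, hu']
  have hbu : b * u = u * b := by
    have h := (cfcₙ_commute_cfcₙ (fun t : ℝ => t) (fun t : ℝ => t / (t ^ 2 + δ ^ 2) * t) b).eq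
    rwa [hid, ← hu'] at h
  have hus : star u = u := by
    have h : IsSelfAdjoint u := hu' ▸ cfcₙ_predicate (fun t : ℝ => t / (t ^ 2 + δ ^ 2) * t) b
    exact h.star_eq
  have hubu : u * b * u =
      cfcₙ (fun t : ℝ => t / (t ^ 2 + δ ^ 2) * t * t * (t / (t ^ 2 + δ ^ 2) * t)) b := by
    rw [cfcₙ_mul (fun t : ℝ => t / (t ^ 2 + δ ^ 2) * t * t)
      (fun t => t / (t ^ 2 + δ ^ 2) * t) b hft.continuousOn (by simp) hf.continuousOn (by simp),
      ← hub, ← hu']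
  have key : inner B (z - u • z) (z - u • z) =
      cfcₙ (fun t : ℝ => (t - t / (t ^ 2 + δ ^ 2) * t * t) - (t / (t ^ 2 + δ ^ 2) * t * t -
        t / (t ^ 2 + δ ^ 2) * t * t * (t / (t ^ 2 + δ ^ 2) * t))) b := by
    rw [cfcₙ_sub (fun t : ℝ => t - t / (t ^ 2 + δ ^ 2) * t * t)
      (fun t => t / (t ^ 2 + δ ^ 2) * t * t -
        t / (t ^ 2 + δ ^ 2) * t * t * (t / (t ^ 2 + δ ^ 2) * t)) b
      (continuous_id.sub hft).continuousOn (by simp) (hft.sub hftf).continuousOn (by simp),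
      cfcₙ_sub (fun t : ℝ => t) (fun t => t / (t ^ 2 + δ ^ 2) * t * t) b continuousOn_id rfl
        hft.continuousOn (by simp),
      cfcₙ_sub (fun t : ℝ => t / (t ^ 2 + δ ^ 2) * t * t)
        (fun t => t / (t ^ 2 + δ ^ 2) * t * t * (t / (t ^ 2 + δ ^ 2) * t)) b
        hft.continuousOn (by simp) hftf.continuousOn (by simp), ← hub, ← hubu, hid]
    simp only [inner_sub_right, inner_sub_left, inner_op_smul_left, inner_op_smul_right, hus,
      ← hb, hbu, mul_sub, mul_assoc]
  rw [norm_sq_eq (A := B), key]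
  refine norm_cfcₙ_le fun t _ => ?_
  have hp : 0 < t ^ 2 + δ ^ 2 := by positivity
  -- With `f = t² / (t² + δ²)` the left side is `t (1 - f)²`, and `1 - f = δ² / (t² + δ²)`.
  have h1 : (t - t / (t ^ 2 + δ ^ 2) * t * t) - (t / (t ^ 2 + δ ^ 2) * t * t -
      t / (t ^ 2 + δ ^ 2) * t * t * (t / (t ^ 2 + δ ^ 2) * t)) =
      t * δ ^ 4 / (t ^ 2 + δ ^ 2) ^ 2 := by
    field_simp
    ring
  rw [h1, Real.norm_eq_abs, abs_div, abs_mul, abs_of_pos (pow_pos hp 2),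
    abs_of_pos (pow_pos hδ 4), div_le_iff₀ (pow_pos hp 2), ← sq_abs t]
  have ht := abs_nonneg t
  have h2 : |t| * δ ≤ |t| ^ 2 + δ ^ 2 := by nlinarith [sq_nonneg (|t| - δ)]
  have h3 : δ ^ 2 ≤ |t| ^ 2 + δ ^ 2 := by nlinarith
  calc |t| * δ ^ 4 = δ * ((|t| * δ) * δ ^ 2) := by ring
    _ ≤ δ * ((|t| ^ 2 + δ ^ 2) * (|t| ^ 2 + δ ^ 2)) := by gcongr
    _ = δ * (|t| ^ 2 + δ ^ 2) ^ 2 := by ring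

end CStarModule

/-! ### Preimages of ideals under correspondences and tensor products. -/

namespace ClosedIdeal

variable {A : Type u} [NonUnitalCStarAlgebra A]

theorem mem_iInf {ι : Sort*} {I : ι → ClosedIdeal A} {x : A} :
    x ∈ (⨅ i, I i).1 ↔ ∀ i, x ∈ (I i).1 := by
  rw [iInf, mem_sInf, Set.forall_mem_range]

end ClosedIdeal

namespace Correspondence

section

variable {A : Type u₁} {B : Type u₂} [NonUnitalCStarAlgebra A]
  [NonUnitalCStarAlgebra B] [PartialOrder B] [StarOrderedRing B]
  (Y : Correspondence.{u₁, u₂, v} A B)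

theorem ip_add_right (x y z : Y) : Y.ip x (y + z) = Y.ip x y + Y.ip x z := by simp [ip]

theorem ip_add_left (x y z : Y) : Y.ip (x + y) z = Y.ip x z + Y.ip y z := by simp [ip]

theorem ip_zero_right (x : Y) : Y.ip x 0 = 0 := by simp [ip]

theorem ip_smul_right (c : ℂ) (x y : Y) : Y.ip x (c • y) = Y.ip (star c • x) y := by simp [ip]

theorem ip_op_smul_right (b : B) (x y : Y) : Y.ip x (op b • y) = Y.ip x y * b := by simp [ip]

theorem continuous_ip (x : Y) : Continuous (Y.ip x) :=
  continuous_unop.comp (CStarModule.innerSL (A := Bᵐᵒᵖ) x).continuous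

/-- `Y I` consists of the vectors whose inner products lie in `I`. -/
theorem mem_mulIdeal {I : ClosedIdeal B} {z : Y} :
    z ∈ Y.mulIdeal I ↔ ∀ x : Y, Y.ip x z ∈ I.1 := by
  constructor
  · let M : Submodule ℂ Y :=
      { carrier := {z | ∀ x : Y, Y.ip x z ∈ I.1}
        add_mem' := fun ha hb x => by
          rw [ip_add_right]
          exact I.1.add_mem (ha x) (hb x)
        zero_mem' := fun x => by
          rw [ip_zero_right]
          exact I.1.zero_mem
        -- The scalar moves into the first variable, where the quantifier over `x` absorbs it; `I`
        -- need not be known to be closed under scalars.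
        smul_mem' := fun c y hy x => by
          rw [ip_smul_right]
          exact hy _ }
    have hM : IsClosed (M : Set Y) := by
      have : (M : Set Y) = ⋂ x : Y, Y.ip x ⁻¹' (I.1 : Set B) := by
        ext z
        simp [M]
      rw [this]
      exact isClosed_iInter fun x => I.2.preimage (Y.continuous_ip x)
    refine fun hz =>
      (Submodule.topologicalClosure_minimal (t := M) _ (Submodule.span_le.2 ?_) hM) hz
    rintro _ ⟨y, b, hb, rfl⟩ x
    rw [ip_op_smul_right]
    exact I.1.mul_mem_left _ _ hb
  · intro h
    refine Metric.mem_closure_iff.2 fun ε hε => ?_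
    -- `z` is approximated by `z · (⟨z, z⟩ w)`, whose coefficient is in `I` because `⟨z, z⟩` is. The
    -- bound is on the squared norm, and halving `ε` makes the inequality strict.
    obtain ⟨w, hw⟩ := CStarModule.exists_norm_sub_mul_inner_self_smul_le (B := Bᵐᵒᵖ) z
      (δ := (ε / 2) ^ 2) (by positivity)
    refine ⟨_, Submodule.subset_span ⟨z, unop (w * inner Bᵐᵒᵖ z z), ?_, rfl⟩, ?_⟩
    · rw [unop_mul]
      exact I.1.mul_mem_right _ _ (h z)
    · rw [dist_eq_norm, op_unop]
      have := (sq_le_sq₀ (norm_nonneg _) (by positivity)).1 hw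
      linarith

/-- To test membership in `Y I`, inner products with a total set of vectors suffice. -/
theorem mem_mulIdeal_of_forall_mem {I : ClosedIdeal B} {S : Set Y}
    (hS : ∀ c : ℂ, ∀ x ∈ S, c • x ∈ S) (hd : (Submodule.span ℂ S).topologicalClosure = ⊤) {z : Y}
    (h : ∀ x ∈ S, Y.ip x z ∈ I.1) : z ∈ Y.mulIdeal I := by
  refine Y.mem_mulIdeal.2 fun x => ?_
  -- Additive closure suffices: by `hS`, the span of `S` is the additive monoid generated by `S`.
  let M : AddSubmonoid Y :=
    { carrier := {x | Y.ip x z ∈ I.1}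
      add_mem' := fun ha hb => by
        rw [Set.mem_ofPred_eq, ip_add_left]
        exact I.1.add_mem ha hb
      zero_mem' := by simp [ip] }
  have hs : (Submodule.span ℂ S).toAddSubmonoid ≤ M := by
    rw [Submodule.span_eq_closure, AddSubmonoid.closure_le]
    rintro _ ⟨c, -, y, hy, rfl⟩
    exact h _ (hS c y hy)
  have hc : IsClosed (M : Set Y) :=
    I.2.preimage (f := fun x => Y.ip x z)
      (continuous_unop.comp (CStarModule.continuous_inner.comp
        (by fun_prop : Continuous fun x : Y => (x, z))))
  have hx : x ∈ (Submodule.span ℂ S).topologicalClosure := hd ▸ Submodule.mem_top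
  exact closure_minimal hs hc hx

theorem mem_preimage_iff_ip {I : ClosedIdeal B} {a : A} :
    a ∈ (Y.preimage I).1 ↔ ∀ x y : Y, Y.ip x (Y.act a y) ∈ I.1 := by
  simp only [mem_preimage, mem_mulIdeal]
  exact forall_comm

/-- Immediate once membership is a conjunction of conditions `⟨x, a y⟩ ∈ I`; closed spans alone
would not show it. -/
theorem preimage_iInf {ι : Sort*} (I : ι → ClosedIdeal B) :
    Y.preimage (⨅ i, I i) = ⨅ i, Y.preimage (I i) := by
  refine Subtype.ext (SetLike.ext fun a => ?_)
  simp only [mem_preimage_iff_ip, ClosedIdeal.mem_iInf]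
  exact ⟨fun h i x y => h x y i, fun h x y i => h i x y⟩

end

/-- `Z⁻¹(I) = X⁻¹(Y⁻¹(I))` whenever `Z ≅ X ⊗ Y`. -/
theorem TensorIso.preimage_eq {A : Type u} {B : Type u₁} {C : Type u₂} [NonUnitalCStarAlgebra A]
    [NonUnitalCStarAlgebra B] [PartialOrder B] [StarOrderedRing B]
    [NonUnitalCStarAlgebra C] [PartialOrder C] [StarOrderedRing C]
    {X : Correspondence.{u, u₁, v₁} A B} {Y : Correspondence.{u₁, u₂, v₂} B C}
    {Z : Correspondence.{u, u₂, v₃} A C} (e : TensorIso X Y Z) (I : ClosedIdeal C) :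
    Z.preimage I = X.preimage (Y.preimage I) := by
  refine Subtype.ext (SetLike.ext fun a => ?_)
  simp only [mem_preimage_iff_ip]
  -- Both directions rest on `⟨x ⊗ y, a (x' ⊗ y')⟩ = ⟨y, ⟨x, a x'⟩ y'⟩`.
  constructor
  · intro h x x' y y'
    rw [← e.inner_mul, e.act_mul]
    exact h _ _
  · intro h z z'
    -- Density of the elementary tensors is used twice, once in each variable of the inner product.
    have hle : (⊤ : Submodule ℂ Z) ≤ (Z.mulIdeal I).comap (Z.act a).toLinearMap := by
      rw [← e.dense]
      refine Submodule.topologicalClosure_minimal _ (Submodule.span_le.2 ?_)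
        ((Submodule.isClosed_topologicalClosure _).preimage (Z.act a).continuous)
      rintro _ ⟨x', y', rfl⟩
      refine Z.mem_mulIdeal_of_forall_mem ?_ e.dense ?_
      · rintro c _ ⟨x, y, rfl⟩
        exact ⟨x, c • y, by simp⟩
      · rintro _ ⟨x, y, rfl⟩
        have := h x x' y y'
        rwa [← e.inner_mul, e.act_mul] at this
    exact Z.mem_mulIdeal.1 (hle Submodule.mem_top) z

end Correspondence

/-! ### Characteristic vectors, lattice orders and infima over subsets. -/

theorem charVec_empty {n : ℕ} : charVec (∅ : Finset (Fin n)) = 0 := by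
  ext; simp [charVec]

theorem charVec_insert {n : ℕ} {F : Finset (Fin n)} {i : Fin n} (hi : i ∉ F) :
    charVec (insert i F) = charVec {i} + charVec F := by
  ext j
  by_cases hj : j = i
  · subst hj; simp [charVec, hi]
  · simp [charVec, hj]

theorem one_sub_charVec {n : ℕ} (F : Finset (Fin n)) : 1 - charVec F = charVec Fᶜ := by
  ext j
  by_cases hj : j ∈ F <;> simp [charVec, hj]

/-- A subset of a complete lattice that is closed under arbitrary infima is a lattice. -/
theorem isLatticeOrder_subtype_of_sInf_mem {L : Type*} [CompleteLattice L] {p : L → Prop}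
    (hp : ∀ S : Set L, (∀ a ∈ S, p a) → p (sInf S)) : IsLatticeOrder {a : L // p a} := by
  have hglb : ∀ S : Set {a : L // p a}, ∃ c, IsGLB S c := fun S =>
    ⟨⟨sInf (Subtype.val '' S), hp _ (by rintro _ ⟨a, -, rfl⟩; exact a.2)⟩,
      fun a ha => sInf_le (a := a.1) ⟨a, ha, rfl⟩,
      fun _ hb => le_sInf (by rintro _ ⟨a, ha, rfl⟩; exact hb ha)⟩
  intro a b
  obtain ⟨c, hc⟩ := hglb (upperBounds {a, b})
  exact ⟨⟨c, isGLB_upperBounds.1 hc⟩, hglb _⟩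

theorem IsLatticeOrder.of_orderIso {P Q : Type*} [PartialOrder P] [PartialOrder Q]
    (h : IsLatticeOrder P) (e : P ≃o Q) : IsLatticeOrder Q := by
  intro a b
  obtain ⟨⟨c, hc⟩, d, hd⟩ := h (e.symm a) (e.symm b)
  refine ⟨⟨e c, ?_⟩, e d, ?_⟩
  · simpa [Set.image_pair] using e.isLUB_image'.2 hc
  · simpa [Set.image_pair] using e.isGLB_image'.2 hd

/-- The subsets of `insert i S` are grouped into pairs `T`, `insert i T`. This drives every
induction and pairing argument below. -/
theorem Finset.iInf_subset_insert {α L : Type*} [DecidableEq α] [CompleteLattice L]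
    (f : Finset α → L) (i : α) (S : Finset α) :
    ⨅ T : Finset α, ⨅ _ : T ⊆ insert i S, f T =
      ⨅ T : Finset α, ⨅ _ : T ⊆ S, f T ⊓ f (insert i T) := by
  refine le_antisymm (le_iInf₂ fun T hT => le_inf ?_ ?_) (le_iInf₂ fun T hT => ?_)
  · exact iInf₂_le (f := fun (T : Finset α) (_ : T ⊆ insert i S) => f T) T
      (Finset.Subset.trans hT (Finset.subset_insert i S))
  · exact iInf₂_le (f := fun (T : Finset α) (_ : T ⊆ insert i S) => f T) (insert i T)
      (Finset.insert_subset_insert i hT)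
  · have hle := iInf₂_le (f := fun (T : Finset α) (_ : T ⊆ S) => f T ⊓ f (insert i T))
      (T.erase i) (Finset.subset_insert_iff.1 hT)
    by_cases hi : i ∈ T
    · simpa only [Finset.insert_erase hi] using hle.trans inf_le_right
    · simpa only [Finset.erase_eq_of_notMem hi] using hle.trans inf_le_left

theorem Finset.notMem_union_of_subset_compl {α : Type*} [Fintype α] [DecidableEq α] {F T : Finset α}
    {i : α} (hi : i ∉ F) (hT : T ⊆ (insert i F)ᶜ) : i ∉ F ∪ T := by
  rw [Finset.mem_union, not_or]
  exact ⟨hi, fun h => Finset.mem_compl.1 (hT h) (Finset.mem_insert_self i F)⟩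

/-! ### Invariant families and T-families. -/

namespace ProductSystem

variable {n : ℕ} {A : Type u} [NonUnitalCStarAlgebra A]

theorem interFamily_eq_iInf_union (K : Finset (Fin n) → ClosedIdeal A) (F : Finset (Fin n)) :
    interFamily K F = ⨅ T : Finset (Fin n), ⨅ _ : T ⊆ Fᶜ, K (F ∪ T) := by
  refine le_antisymm (le_iInf₂ fun T _ => iInf₂_le _ Finset.subset_union_left)
    (le_iInf₂ fun G hG => (iInf₂_le (G \ F) ?_).trans_eq ?_)
  · exact fun x hx => Finset.mem_compl.2 (Finset.mem_sdiff.1 hx).2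
  · rw [Finset.union_sdiff_of_subset hG]

theorem interFamily_eq_iInf_insert (K : Finset (Fin n) → ClosedIdeal A) {F : Finset (Fin n)}
    {i : Fin n} (hi : i ∉ F) :
    interFamily K F = ⨅ T : Finset (Fin n), ⨅ _ : T ⊆ (insert i F)ᶜ,
      K (F ∪ T) ⊓ K (insert i (F ∪ T)) := by
  have h : Fᶜ = insert i (insert i F)ᶜ := by
    ext j
    by_cases hj : j = i
    · simp [hj, hi]
    · simp [hj]
  rw [interFamily_eq_iInf_union, h, Finset.iInf_subset_insert]
  simp only [Finset.union_insert]

theorem interFamily_mono : Monotone (interFamily (n := n) (A := A)) :=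
  fun _ _ h _ => iInf₂_mono fun G _ => h G

variable [PartialOrder A] [StarOrderedRing A] (X : ProductSystem.{u, v} n A)

theorem preimage_zero (I : ClosedIdeal A) : X.preimage 0 I = I := by simp [preimage]

theorem preimage_iInf {ι : Sort*} (m : Fin n → ℕ) (I : ι → ClosedIdeal A) :
    X.preimage m (⨅ i, I i) = ⨅ i, X.preimage m (I i) := by
  by_cases hm : m = 0
  · simp [preimage, hm]
  · simp [preimage, hm, Correspondence.preimage_iInf]

theorem preimage_inf (m : Fin n → ℕ) (I J : ClosedIdeal A) :
    X.preimage m (I ⊓ J) = X.preimage m I ⊓ X.preimage m J := by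
  rw [inf_eq_iInf, preimage_iInf, inf_eq_iInf]
  exact iInf_congr fun b => by cases b <;> rfl

theorem preimage_mono (m : Fin n → ℕ) : Monotone (X.preimage m) := fun I J h => by
  rw [← inf_eq_left, ← preimage_inf, inf_eq_left.2 h]

/-- The product structure enters here. Since addition in `ℕⁿ` commutes, so do the maps `X.preimage
m`. -/
theorem preimage_add (m k : Fin n → ℕ) (I : ClosedIdeal A) :
    X.preimage (m + k) I = X.preimage m (X.preimage k I) := by
  by_cases hm : m = 0
  · rw [hm, zero_add, preimage_zero]
  by_cases hk : k = 0
  · rw [hk, add_zero, preimage_zero]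
  have hmk : m + k ≠ 0 := fun h => hm (by
    ext i
    have := congrFun h i
    simp only [Pi.add_apply, Pi.zero_apply] at this ⊢
    omega)
  simp only [preimage, hm, hk, hmk, dif_neg, not_false_eq_true]
  exact (X.mulIso ⟨m, hm⟩ ⟨k, hk⟩ ⟨m + k, hmk⟩ rfl).preimage_eq I

theorem preimage_charVec_insert {F : Finset (Fin n)} {i : Fin n} (hi : i ∉ F) (I : ClosedIdeal A) :
    X.preimage (charVec (insert i F)) I = X.preimage (charVec F) (X.preimage (charVec {i}) I) := by
  rw [charVec_insert hi, add_comm, preimage_add]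

theorem preimageFamily_apply (I : Finset (Fin n) → ClosedIdeal A) (F : Finset (Fin n)) :
    X.preimageFamily I F = X.preimage (charVec Fᶜ) (I F) := by
  rw [preimageFamily, one_sub_charVec]

theorem isTFamily_sInf (S : Set (Finset (Fin n) → ClosedIdeal A)) (hS : ∀ I ∈ S, X.IsTFamily I) :
    X.IsTFamily (sInf S) := by
  intro F i hi
  simp only [sInf_apply, preimage_iInf, ← iInf_inf_eq]
  exact iInf_congr fun I => hS I.1 I.2 F i hi

variable {X}

/-- Pair the sets containing `F` as `G = F ∪ T` and `insert i G`. Invariance turns `p_i` of each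
pair's meet into `K^G`, and the meet with `K^{G ∪ {i}}` restores the pair. -/
theorem IsInvariantFamily.isTFamily {K : Finset (Fin n) → ClosedIdeal A}
    (hK : X.IsInvariantFamily K) : X.IsTFamily (interFamily K) := by
  intro F i hi
  rw [interFamily_eq_iInf_union K (insert i F), interFamily_eq_iInf_insert K hi]
  simp only [preimage_iInf, ← iInf_inf_eq]
  refine iInf_congr fun T => iInf_congr fun hT => ?_
  rw [← hK _ _ (Finset.notMem_union_of_subset_compl hi hT), Finset.insert_union]

/-- With `S = (G ∪ {i})ᶜ`, the meet `K_I^G ∩ K_I^{G ∪ {i}}` is `p_S(p_i(I^G) ∩ I^{G ∪ {i}}) =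
p_S(I^G)`. Applying `p_i` gives `K_I^G`. -/
theorem IsTFamily.isInvariantFamily {I : Finset (Fin n) → ClosedIdeal A}
    (hI : X.IsTFamily I) : X.IsInvariantFamily (X.preimageFamily I) := by
  intro G i hi
  have h : Gᶜ = insert i (insert i G)ᶜ := by
    ext j
    by_cases hj : j = i
    · simp [hj, hi]
    · simp [hj]
  have hi' : i ∉ (insert i G)ᶜ := by simp
  simp only [preimageFamily_apply]
  rw [h, preimage_charVec_insert _ hi', ← preimage_inf, ← hI G i hi, ← preimage_add,
    add_comm, preimage_add]

/-- Induction on `S`: the pair `T`, `insert i T` contributes `p_{S \ T}` of `p_i(I^{F ∪ T}) ∩ I^{F ∪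
T ∪ {i}}`, which the T-identity collapses to `I^{F ∪ T}`. -/
theorem IsTFamily.eq_iInf_preimage {I : Finset (Fin n) → ClosedIdeal A} (hI : X.IsTFamily I)
    (F S : Finset (Fin n)) (hS : Disjoint F S) :
    I F = ⨅ T : Finset (Fin n), ⨅ _ : T ⊆ S, X.preimage (charVec (S \ T)) (I (F ∪ T)) := by
  induction S using Finset.induction_on with
  | empty => simp [Finset.subset_empty, charVec_empty, preimage_zero]
  | insert i S hi ih =>
    rw [Finset.disjoint_insert_right] at hS
    rw [Finset.iInf_subset_insert, ih hS.2]
    refine iInf_congr fun T => iInf_congr fun hT => ?_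
    have hiT : i ∉ T := fun h => hi (hT h)
    rw [Finset.insert_sdiff_of_notMem _ hiT, Finset.insert_sdiff_insert,
      Finset.sdiff_insert_of_notMem hi,
      preimage_charVec_insert _ (fun h => hi (Finset.mem_sdiff.1 h).1), ← preimage_inf,
      Finset.union_insert, ← hI]
    simp [hS.1, hiT]

/-- Induction on `S`: `p_i`, applied first, collapses each pair to `K^{F ∪ T}` by invariance,
leaving the statement for the smaller set. -/
theorem IsInvariantFamily.preimage_iInf_eq {K : Finset (Fin n) → ClosedIdeal A}
    (hK : X.IsInvariantFamily K) (F S : Finset (Fin n)) (hS : Disjoint F S) :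
    X.preimage (charVec S) (⨅ T : Finset (Fin n), ⨅ _ : T ⊆ S, K (F ∪ T)) = K F := by
  induction S using Finset.induction_on with
  | empty => simp [Finset.subset_empty, charVec_empty, preimage_zero]
  | insert i S hi ih =>
    rw [Finset.disjoint_insert_right] at hS
    rw [Finset.iInf_subset_insert, preimage_charVec_insert _ hi, ← ih hS.2]
    congr 1
    simp only [preimage_iInf]
    refine iInf_congr fun T => iInf_congr fun hT => ?_
    rw [Finset.union_insert, ← hK]
    simpa [hS.1] using fun h => hi (hT h)

theorem IsTFamily.interFamily_preimageFamily {I : Finset (Fin n) → ClosedIdeal A}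
    (hI : X.IsTFamily I) : interFamily (X.preimageFamily I) = I := by
  funext F
  rw [interFamily_eq_iInf_union, hI.eq_iInf_preimage F Fᶜ disjoint_compl_right]
  refine iInf_congr fun T => iInf_congr fun _ => ?_
  rw [preimageFamily_apply, Finset.compl_union, ← Finset.sdiff_eq_inter_compl]

theorem IsInvariantFamily.preimageFamily_interFamily {K : Finset (Fin n) → ClosedIdeal A}
    (hK : X.IsInvariantFamily K) : X.preimageFamily (interFamily K) = K := by
  funext F
  rw [preimageFamily_apply, interFamily_eq_iInf_union,
    hK.preimage_iInf_eq F Fᶜ disjoint_compl_right]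

variable (X) in
theorem preimageFamily_mono : Monotone X.preimageFamily :=
  fun _ _ h F => X.preimage_mono _ (h F)

variable (X) in
/-- The isomorphism `K ↦ I_K` between the invariant families and the T-families, with inverse
`I ↦ K_I`. -/
def invariantFamilyIso : X.InvariantFamily ≃o X.TFamily :=
  Equiv.toOrderIso
    { toFun := fun K => ⟨interFamily K.1, K.2.isTFamily⟩
      invFun := fun I => ⟨X.preimageFamily I.1, I.2.isInvariantFamily⟩
      left_inv := fun K => Subtype.ext K.2.preimageFamily_interFamily
      right_inv := fun I => Subtype.ext I.2.interFamily_preimageFamily }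
    (fun _ _ h => interFamily_mono h) (fun _ _ h => X.preimageFamily_mono h)

end ProductSystem

theorem propositionp {n : ℕ} {A : Type u} [NonUnitalCStarAlgebra A] [PartialOrder A]
    [StarOrderedRing A] (X : ProductSystem.{u, v} n A) (hX : X.IsProper) :
    IsLatticeOrder X.InvariantFamily ∧ IsLatticeOrder X.TFamily ∧
      ∃ e : X.InvariantFamily ≃o X.TFamily,
        (∀ K : X.InvariantFamily, (e K).1 = ProductSystem.interFamily K.1) ∧
        (∀ I : X.TFamily, (e.symm I).1 = X.preimageFamily I.1) := by
  have hT : IsLatticeOrder X.TFamily := isLatticeOrder_subtype_of_sInf_mem X.isTFamily_sInf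
  exact ⟨hT.of_orderIso X.invariantFamilyIso.symm, hT, X.invariantFamilyIso, fun _ => rfl,
    fun _ => rfl⟩
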